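/- **Theorem.** Let $k$ be an algebraically closed field of characteristic zero, and let $\mathcal{C}$ be a finite tensor category over $k$: a $k$-linear abelian rigid monoidal category whose tensor product is $k$-linear in both variables, whose unit object is simple, in which every object has finite length and every hom-set is finite-dimensional over $k$, and which is $k$-linearly equivalent to the category of finitely generated modules over a finite-dimensional $k$-algebra. Let $G(\mathcal{C}) = \mathrm{Aut}_\otimes(\mathrm{id}_{\mathcal{C}})$ be the group of monoidal natural automorphisms of the identity functor of $\mathcal{C}$, let $I$ be the set of isomorphism classes of simple objects of $\mathcal{C}$, and choose a representative $S_i$ of each $i \in I$. For $i, j, m \in I$ let $N_{ij}^m$ be the multiplicity of $S_m$ as a composition factor of $S_i \otimes S_j$. Call two indecomposable objects in the same block if they are equivalent under the smallest equivalence relation on the indecomposable objects of $\mathcal{C}$ such that $X$ and $Y$ are equivalent whenever $\mathrm{Hom}_{\mathcal{C}}(X, Y) \neq 0$. Let $\Lambda$ be the group, under pointwise multiplication, of all functions $\lambda : I \to k^\times$ such that 1. $\lambda(i)\lambda(j) = \lambda(m)$ for all $i, j, m \in I$ with $N_{ij}^m \neq 0$, and 2. $\lambda(i) = \lambda(j)$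 for all $i, j \in I$ such that $S_i$ and $S_j$ belong to the same block. Then each $g \in G(\mathcal{C})$ acts on each $S_i$ as $g|_{S_i} = \lambda_g(i)\,\mathrm{id}_{S_i}$ for a unique scalar $\lambda_g(i) \in k^\times$, the function $\lambda_g$ lies in $\Lambda$, and the map $g \mapsto \lambda_g$ is an isomorphism of groups from $G(\mathcal{C})$ onto $\Lambda$. -/

import Mathlib

open CategoryTheory CategoryTheory.Limits CategoryTheory.MonoidalCategory

universe w v u

namespace FinTensorCat

section Length

variable {C : Type u} [Category.{v} C] [Abelian C]

/-- A composition series of `X`: a chain of subobjects `0 = X₀ ≤ X₁ ≤ ⋯ ≤ Xₙ = X` all of whose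
successive quotients are simple. -/
structure CompSeries (X : C) where
  length : ℕ
  sub : Fin (length + 1) → Subobject X
  step : ∀ i : Fin length, sub i.castSucc ≤ sub i.succ
  simple_quotient : ∀ i : Fin length, Simple (cokernel (Subobject.ofLE _ _ (step i)))
  sub_zero : sub 0 = ⊥
  sub_last : sub (Fin.last length) = ⊤

/-- The `i`-th composition factor `Xᵢ₊₁ / Xᵢ` of a composition series. -/
noncomputable def CompSeries.factor {X : C} (s : CompSeries X) (i : Fin s.length) : C :=
  cokernel (Subobject.ofLE _ _ (s.step i))

/-- The object `X` has finite length. -/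
def HasFiniteLength (X : C) : Prop := Nonempty (CompSeries X)

/-- The number of factors of a composition series that are isomorphic to `S`. -/
noncomputable def CompSeries.count {X : C} (s : CompSeries X) (S : C) : ℕ :=
  Nat.card {i : Fin s.length // Nonempty (s.factor i ≅ S)}

/-- The multiplicity of `S` as a composition factor of `X`. By the Jordan–Hölder theorem all
composition series of `X` have the same number of factors isomorphic to `S`, so that the supremum
is the supremum of a constant family. -/
noncomputable def compMultiplicity (X S : C) : ℕ∞ :=
  ⨆ s : CompSeries X, (s.count S : ℕ∞)

end Length

section Simples

variable (C : Type u) [Category.{v} C] [Abelian C]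

/-- Isomorphism of simple objects, as an equivalence relation. -/
def simpleSetoid : Setoid {X : C // Simple X} where
  r X Y := Nonempty (X.1 ≅ Y.1)
  iseqv :=
    { refl := fun X => ⟨Iso.refl X.1⟩
      symm := fun ⟨e⟩ => ⟨e.symm⟩
      trans := fun ⟨e⟩ ⟨f⟩ => ⟨e.trans f⟩ }

/-- The set of isomorphism classes of simple objects of `C`. -/
def SimpleClass : Type u := Quotient (simpleSetoid C)

/-- The isomorphism class of a simple object. -/
def SimpleClass.mk (X : {X : C // Simple X}) : SimpleClass C := Quotient.mk (simpleSetoid C) X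

variable {C}

/-- The relation on indecomposable objects that there is a nonzero morphism `X ⟶ Y`. -/
def HasNonzeroHom (X Y : {X : C // Indecomposable X}) : Prop := ∃ f : X.1 ⟶ Y.1, f ≠ 0

/-- Two indecomposable objects belong to the same block: they are equivalent under the equivalence
relation generated by the existence of a nonzero morphism. -/
def SameBlock (X Y : {X : C // Indecomposable X}) : Prop := Relation.EqvGen HasNonzeroHom X Y

/-- A simple object, regarded as an indecomposable object. -/
def simpleToIndecomposable (X : {X : C // Simple X}) : {X : C // Indecomposable X} :=
  ⟨X.1, haveI := X.2; indecomposable_of_simple X.1⟩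

end Simples

section TensorCategories

variable (k : Type w) [Field k] (C : Type u) [Category.{v} C] [Abelian C] [Linear k C]

/-- A `k`-linear abelian category is finite if it is `k`-linearly equivalent to the category of
finitely generated modules over a finite-dimensional `k`-algebra. -/
def IsFiniteAbelian : Prop :=
  ∃ (A : Type v) (_ : Ring A) (_ : Algebra k A) (E : C ≌ FGModuleCat.{v} A),
    Module.Finite k A ∧ E.functor.Additive ∧ E.functor.Linear k

/-- The conditions which make a `k`-linear abelian rigid monoidal category with `k`-bilinear tensor
product a tensor category over `k`. -/
class IsTensorCategory [MonoidalCategory C] [RigidCategory C] [MonoidalPreadditive C]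
    [MonoidalLinear k C] : Prop where
  simple_unit : Simple (𝟙_ C)
  finite_length : ∀ X : C, HasFiniteLength X
  finite_hom : ∀ X Y : C, Module.Finite k (X ⟶ Y)

end TensorCategories

section Groups

/-- The group `Aut_⊗(id_C)` of monoidal natural automorphisms of the identity functor. -/
def tensorAutId (C : Type u) [Category.{v} C] [MonoidalCategory C] : Subgroup (Aut (𝟭 C)) where
  carrier := {g | NatTrans.IsMonoidal g.hom}
  one_mem' := inferInstanceAs (NatTrans.IsMonoidal (𝟙 (𝟭 C)))
  mul_mem' {g h} hg hh := by
    have : NatTrans.IsMonoidal g.hom := hg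
    have : NatTrans.IsMonoidal h.hom := hh
    exact inferInstanceAs (NatTrans.IsMonoidal (h.hom ≫ g.hom))
  inv_mem' {g} hg := by
    let e : 𝟭 C ≅ 𝟭 C := g
    have : NatTrans.IsMonoidal e.hom := hg
    exact inferInstanceAs (NatTrans.IsMonoidal e.inv)

variable (k : Type w) [Field k] {C : Type u} [Category.{v} C] [Abelian C] [MonoidalCategory C]

/-- Let `S i` be a simple object for each isomorphism class `i` of simple objects. This is the group
of functions `l : I → kˣ` with `l i * l j = l m` whenever the multiplicity `N_{ij}^m` of `S m` in
`S i ⊗ S j` is nonzero, and `l i = l j` whenever `S i` and `S j` belong to the same block. -/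
def fusionFunctions (S : SimpleClass C → {X : C // Simple X}) : Subgroup (SimpleClass C → kˣ) where
  carrier := {l | (∀ i j m, compMultiplicity ((S i).1 ⊗ (S j).1) (S m).1 ≠ 0 → l i * l j = l m) ∧
    ∀ i j, SameBlock (simpleToIndecomposable (S i)) (simpleToIndecomposable (S j)) → l i = l j}
  one_mem' := ⟨fun _ _ _ _ => by simp, fun _ _ _ => rfl⟩
  mul_mem' {a b} ha hb :=
    ⟨fun i j m h => by
      simp only [Pi.mul_apply]
      rw [← ha.1 i j m h, ← hb.1 i j m h, mul_mul_mul_comm],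
     fun i j h => by simp only [Pi.mul_apply]; rw [ha.2 i j h, hb.2 i j h]⟩
  inv_mem' {a} ha :=
    ⟨fun i j m h => by simp only [Pi.inv_apply]; rw [← ha.1 i j m h, mul_inv],
     fun i j h => by simp only [Pi.inv_apply]; rw [ha.2 i j h]⟩

end Groups

end FinTensorCat

/-!
A monoidal automorphism `g` of the identity functor acts on a simple object by a scalar, by Schur's
lemma. The scalars are multiplicative because naturality passes them to subquotients of tensor
products (`mem_fusionFunctions`), and constant on blocks because the endomorphism ring of an
indecomposable object has no nontrivial idempotents, so that `g` is there the sum of a scalar and a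
nilpotent (`exists_isNilpotent_sub_algebraMap`), and nonzero morphisms preserve this scalar
(`eq_of_sameBlock`).

Injectivity says that a `g` acting trivially on simple objects is the identity. Such a `g` is
unipotent, and `ν = g - 1` is nilpotent on all objects at once, since the identity functor of a
finite category is controlled by one generator. If `n + 1 ≥ 2` were the nilpotency index of `ν`,
with `ν ^ n` nonzero at `X`, then on `X ⊗ X` one would have `ν = (1 + a) (1 + b) - 1` with
`a = ν ⊗ 1` and `b = 1 ⊗ ν`, and `ν ^ (2 * n)` would be `(2n choose n) (ν ^ n ⊗ ν ^ n)` up to a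
unit. This is nonzero because the characteristic is zero and because the tensor product of nonzero
morphisms is nonzero (`tensorHom_ne_zero`), but `2 * n ≥ n + 1`: a contradiction
(`pow_two_mul_ne_zero`, `eq_id_of_component_simple_eq_id`).

For surjectivity, a function `l` constant on blocks gives each indecomposable object a scalar, and
hence, through decompositions into indecomposables, an endomorphism of each object. These form a
natural transformation because there are no nonzero morphisms between objects of different blocks
(`blockEnd`). Naturality also determines the scalars on subquotients, so no projective covers are
needed to compare an indecomposable object with its composition factors. As `blockEnd` is semisimple
(`component_blockEnd_eq_smul_of_sq_eq_zero`), its monoidality reduces, by dévissage in both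
variables, to products of simple objects (`component_tensor_eq_smul`), where it is the
multiplicativity of `l`.
-/

/-! ### Commutation, nilpotency and idempotents in algebras -/

/-- If `a` and `b` commute and have nilpotency index `n + 1`, then in the expansion of
`((1 + a) * (1 + b) - 1) ^ (2 * n) = (a * (1 + b) + b) ^ (2 * n)` only the middle term
`(2n choose n) * a ^ n * b ^ n * (1 + b) ^ n` survives, and `1 + b` is a unit. -/
theorem Commute.one_add_mul_one_add_sub_one_pow_ne_zero (k : Type*) {A : Type*} [Field k]
    [CharZero k] [Ring A] [Algebra k A] {a b : A} (hab : Commute a b) {n : ℕ}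
    (ha : a ^ (n + 1) = 0) (hb : b ^ (n + 1) = 0) (h : a ^ n * b ^ n ≠ 0) :
    ((1 + a) * (1 + b) - 1) ^ (2 * n) ≠ 0 := by
  have hu : IsUnit ((1 + b) ^ n) := (IsNilpotent.isUnit_one_add ⟨_, hb⟩).pow n
  have hab' : Commute a (1 + b) := (Commute.one_right a).add_right hab
  have hbb : Commute (1 + b) b := (Commute.one_left b).add_left (Commute.refl b)
  have hc : Commute (a * (1 + b)) b := hab.mul_left hbb
  have hexp : ((1 + a) * (1 + b) - 1) ^ (2 * n) =
      ((2 * n).choose n : k) • (a ^ n * b ^ n * (1 + b) ^ n) := by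
    have : (1 + a) * (1 + b) - 1 = a * (1 + b) + b := by noncomm_ring
    rw [this, hc.add_pow, Finset.sum_eq_single n]
    · rw [hab'.mul_pow, show 2 * n - n = n by omega, mul_assoc (a ^ n),
        (hbb.pow_pow n n).eq, ← mul_assoc, Nat.cast_smul_eq_nsmul, nsmul_eq_mul, Nat.cast_comm]
    · intro m _ hm
      rcases lt_or_gt_of_ne hm with h' | h'
      · rw [pow_eq_zero_of_le (show n + 1 ≤ 2 * n - m by omega) hb, mul_zero, zero_mul]
      · rw [hab'.mul_pow, pow_eq_zero_of_le (show n + 1 ≤ m by omega) ha, zero_mul, zero_mul,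
          zero_mul]
    · intro hn
      exact absurd (Finset.mem_range.2 (by omega)) hn
  rw [hexp]
  refine smul_ne_zero (Nat.cast_ne_zero.2 (Nat.choose_pos (by omega)).ne') fun h0 => h ?_
  exact hu.mul_left_eq_zero.1 h0

/-- In a finite-dimensional algebra over an algebraically closed field whose only idempotents are
`0` and `1`, every element is the sum of a scalar and a nilpotent element: if `c` is a root of
multiplicity `m` of the minimal polynomial `(X - c) ^ m * q` of `x`, the Bézout relation between
`(X - c) ^ m` and `q` evaluates at `x` to a decomposition of `1` into complementary idempotents. -/
theorem exists_isNilpotent_sub_algebraMap {k A : Type*} [Field k] [IsAlgClosed k] [Ring A]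
    [Algebra k A] [Module.Finite k A] [Nontrivial A]
    (hA : ∀ e : A, e * e = e → e = 0 ∨ e = 1) (x : A) :
    ∃ c : k, IsNilpotent (x - algebraMap k A c) := by
  have hx : IsIntegral k x := Algebra.IsIntegral.isIntegral x
  obtain ⟨c, hc⟩ := IsAlgClosed.exists_root (minpoly k x) (minpoly.degree_pos hx).ne'
  obtain ⟨q, hq, hnd⟩ := Polynomial.exists_eq_pow_rootMultiplicity_mul_and_not_dvd
    (minpoly k x) (minpoly.ne_zero hx) c
  set m := (minpoly k x).rootMultiplicity c
  have hcop : IsCoprime ((Polynomial.X - Polynomial.C c) ^ m) q :=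
    (((Polynomial.irreducible_X_sub_C c).coprime_iff_not_dvd).2 hnd).pow_left
  obtain ⟨a, b, hab⟩ := hcop
  have h0 : Polynomial.aeval x ((Polynomial.X - Polynomial.C c) ^ m * q) = 0 := by
    rw [← hq, minpoly.aeval]
  refine ⟨c, m, ?_⟩
  have hpow : (x - algebraMap k A c) ^ m =
      Polynomial.aeval x ((Polynomial.X - Polynomial.C c) ^ m) := by simp
  rw [hpow]
  set p := (Polynomial.X - Polynomial.C c) ^ m
  have hidem : Polynomial.aeval x (a * p) * Polynomial.aeval x (a * p) =
      Polynomial.aeval x (a * p) := by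
    have : a * p * (a * p) = a * p - a * b * (p * q) := by linear_combination (a * p) * hab
    rw [← map_mul, this, map_sub, map_mul _ (a * b), h0]
    simp
  rcases hA _ hidem with he | he
  · -- here `b q` evaluates to `1`, so `p` evaluates to `p b q = 0`
    have : p = p * (a * p) + b * (p * q) := by linear_combination (-p) * hab
    rw [this, map_add, map_mul _ p, map_mul _ b, he, h0]
    simp
  · -- here `q` evaluates to `a p q = 0`, so the minimal polynomial divides `q`
    refine absurd (((Polynomial.dvd_iff_isRoot).2 hc).trans (minpoly.dvd k x ?_)) hnd
    have : q = q * (1 - a * p) + a * (p * q) := by ring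
    rw [this, map_add, map_mul, map_mul _ a, h0, map_sub, he]
    simp

namespace FinTensorCat

/-! ### Dévissage along composition series -/

section Devissage

variable {C : Type u} [Category.{v} C] [Abelian C]

/-- Dévissage along a composition series: a property of objects which holds for zero objects and
for the factors of the series and is stable under extensions holds for the object. -/
theorem CompSeries.induction {X : C} (s : CompSeries X) {P : C → Prop}
    (zero : ∀ Z, IsZero Z → P Z)
    (ext : ∀ {Y Z : C} (i : Y ⟶ Z) [Mono i], P Y → P (cokernel i) → P Z)
    (factor : ∀ j, P (s.factor j)) : P X := by
  have iso {Y Z : C} (e : Y ≅ Z) (h : P Y) : P Z :=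
    ext e.hom h (zero _ (isZero_cokernel_of_epi e.hom))
  have key : ∀ j : Fin (s.length + 1), P (s.sub j : C) := by
    intro j
    induction j using Fin.induction with
    | zero =>
      rw [s.sub_zero]
      exact zero _ ((isZero_zero C).of_iso Subobject.botCoeIsoZero)
    | succ j ih => exact ext (Subobject.ofLE _ _ (s.step j)) ih (factor j)
  have := key (Fin.last _)
  rw [s.sub_last] at this
  exact iso (asIso (⊤ : Subobject X).arrow) this

/-- Dévissage for objects of finite length. -/
theorem HasFiniteLength.induction {X : C} (hX : HasFiniteLength X) {P : C → Prop}
    (zero : ∀ Z, IsZero Z → P Z)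
    (ext : ∀ {Y Z : C} (i : Y ⟶ Z) [Mono i], P Y → P (cokernel i) → P Z)
    (simple : ∀ Z, Simple Z → P Z) : P X :=
  hX.some.induction zero ext fun j => simple _ (hX.some.simple_quotient j)

theorem HasFiniteLength.exists_nonzero_hom_simple {X : C} (hX : HasFiniteLength X)
    (h : ¬IsZero X) : ∃ Z : C, Simple Z ∧ ∃ f : X ⟶ Z, f ≠ 0 := by
  revert h
  refine hX.induction (P := fun X => ¬IsZero X → ∃ Z : C, Simple Z ∧ ∃ f : X ⟶ Z, f ≠ 0)
    (fun Z hZ h => absurd hZ h) ?_ ?_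
  · intro Y Z i _ hY hQ hZ
    by_cases hq : IsZero (cokernel i)
    -- if the cokernel vanishes, then `i` is an isomorphism and the morphism comes from `Y`
    · have : Epi i := Preadditive.epi_of_cancel_zero _ fun g hg => by
        rw [← cokernel.π_desc i g hg, hq.eq_of_tgt (cokernel.π i) 0, zero_comp]
      have : IsIso i := isIso_of_mono_of_epi i
      obtain ⟨T, hT, f, hf⟩ := hY fun h => hZ (h.of_iso (asIso i).symm)
      refine ⟨T, hT, inv i ≫ f, fun h => hf ?_⟩
      rw [← IsIso.hom_inv_id_assoc i f, h, comp_zero]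
    · obtain ⟨T, hT, f, hf⟩ := hQ hq
      exact ⟨T, hT, cokernel.π i ≫ f, fun h => hf (zero_of_epi_comp _ h)⟩
  · intro Z hZ _
    exact ⟨Z, hZ, 𝟙 Z, id_nonzero Z⟩

theorem exists_count_ne_zero_of_compMultiplicity_ne_zero {X Y : C}
    (h : compMultiplicity X Y ≠ 0) :
    ∃ (s : CompSeries X) (j : Fin s.length), Nonempty (s.factor j ≅ Y) := by
  by_contra! hs
  refine h (le_antisymm (iSup_le fun s => ?_) bot_le)
  have : IsEmpty {j : Fin s.length // Nonempty (s.factor j ≅ Y)} :=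
    ⟨fun j => (hs s j.1).false j.2.some⟩
  simp [CompSeries.count]

theorem CompSeries.compMultiplicity_ne_zero {X Y : C} (s : CompSeries X) (j : Fin s.length)
    (e : s.factor j ≅ Y) : compMultiplicity X Y ≠ 0 := by
  have : Nonempty {j : Fin s.length // Nonempty (s.factor j ≅ Y)} := ⟨⟨j, ⟨e⟩⟩⟩
  have h1 : s.count Y ≠ 0 := Nat.card_pos.ne'
  intro h0
  have := (le_iSup (fun s : CompSeries X => (s.count Y : ℕ∞)) s).trans_eq h0
  exact h1 (by simpa using this)

/-- If a right exact functor `F` is applied to `i` and its cokernel, then a morphism to `F Z` killed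
by the quotient map followed by a morphism from `F Z` killed by `F i` vanishes. -/
theorem comp_eq_zero_of_map_cokernel {D : Type*} [Category* D] [Preadditive D] (F : C ⥤ D)
    [F.PreservesZeroMorphisms] [PreservesColimitsOfShape WalkingParallelPair F]
    {Y Z : C} (i : Y ⟶ Z) {W V : D} {f : W ⟶ F.obj Z} {g : F.obj Z ⟶ V}
    (hf : f ≫ F.map (cokernel.π i) = 0) (hg : F.map i ≫ g = 0) : f ≫ g = 0 := by
  obtain ⟨l, hl⟩ := CokernelCofork.IsColimit.desc'
    (isColimitOfHasCokernelOfPreservesColimit F i) g hg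
  rw [← hl]
  change f ≫ F.map (cokernel.π i) ≫ l = 0
  rw [reassoc_of% hf, zero_comp]

end Devissage

/-! ### Indecomposable objects -/

section Indecomposable

variable {C : Type u} [Category.{v} C] [Abelian C]

/-- An idempotent and its complement split in an abelian category, and the two summands give a
biproduct decomposition. -/
theorem _root_.CategoryTheory.Indecomposable.eq_zero_or_eq_id {X : C} (hX : Indecomposable X)
    {e : X ⟶ X} (he : e ≫ e = e) : e = 0 ∨ e = 𝟙 X := by
  obtain ⟨Y, i, p, hip, hpi⟩ := IsIdempotentComplete.idempotents_split X e he
  obtain ⟨Z, j, q, hjq, hqj⟩ := IsIdempotentComplete.idempotents_split X (𝟙 X - e)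
    (by simp [he])
  have hiq : i ≫ q = 0 := by
    have : i ≫ q ≫ j = 0 := by
      rw [hqj, ← hpi, Preadditive.comp_sub, Category.comp_id, reassoc_of% hip, sub_self]
    rw [← Category.comp_id q, ← hjq, reassoc_of% this, zero_comp]
  have hjp : j ≫ p = 0 := by
    have : (j ≫ p) ≫ i = 0 := by
      rw [Category.assoc, hpi, ← sub_sub_cancel (𝟙 X) e, ← hqj, Preadditive.comp_sub,
        Category.comp_id, reassoc_of% hjq, sub_self]
    rw [← Category.comp_id p, ← hip, ← Category.assoc p, ← Category.assoc, ← Category.assoc,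
      this, zero_comp]
  let E : X ≅ Y ⊞ Z :=
    { hom := biprod.lift p q
      inv := biprod.desc i j
      hom_inv_id := by rw [biprod.lift_desc, hpi, hqj, add_sub_cancel]
      inv_hom_id := by ext <;> simp [hip, hiq, hjp, hjq] }
  rcases hX.2 Y Z E with h | h
  · left
    rw [← hpi, h.eq_of_tgt p 0, zero_comp]
  · right
    have : 𝟙 X - e = 0 := by rw [← hqj, h.eq_of_tgt q 0, zero_comp]
    exact (sub_eq_zero.1 this).symm

theorem _root_.CategoryTheory.Indecomposable.exists_isNilpotent_sub_smul_id (k : Type w) [Field k]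
    [IsAlgClosed k] [Linear k C] {X : C} [Module.Finite k (X ⟶ X)] (hX : Indecomposable X)
    (f : End X) : ∃ c : k, IsNilpotent (f - c • (1 : End X)) := by
  have : Module.Finite k (End X) := ‹_›
  have : Nontrivial (End X) := ⟨⟨1, 0, fun h => hX.1 ((IsZero.iff_id_eq_zero X).2 h)⟩⟩
  obtain ⟨c, hc⟩ := exists_isNilpotent_sub_algebraMap (k := k) (A := End X)
    (fun e he => hX.eq_zero_or_eq_id he) f
  exact ⟨c, by rwa [Algebra.algebraMap_eq_smul_one] at hc⟩

/-- A presentation of `X` as a finite sum of indecomposable objects, by morphisms `ι` and `π` with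
`∑ j, π j ≫ ι j = 𝟙 X`. Orthogonality of the summands is not recorded, since it is not used. -/
structure IndecDecomp (X : C) where
  /-- the index set of the summands -/
  J : Type
  [fintype : Fintype J]
  /-- the summands -/
  obj : J → C
  indec : ∀ j, Indecomposable (obj j)
  /-- the inclusions -/
  ι : ∀ j, obj j ⟶ X
  /-- the projections -/
  π : ∀ j, X ⟶ obj j
  total : ∑ j, π j ≫ ι j = 𝟙 X

attribute [instance] IndecDecomp.fintype

/-- The existence part of the Krull–Schmidt theorem, by induction on the dimension of `End X`. -/
theorem nonempty_indecDecomp (k : Type w) [Field k] [Linear k C]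
    [∀ X Y : C, Module.Finite k (X ⟶ Y)] (X : C) : Nonempty (IndecDecomp X) := by
  induction h : Module.finrank k (X ⟶ X) using Nat.strong_induction_on generalizing X with
  | _ n ih =>
  by_cases h0 : IsZero X
  · exact ⟨⟨Empty, Empty.elim, fun j => j.elim, fun j => j.elim, fun j => j.elim,
      h0.eq_of_src _ _⟩⟩
  by_cases hX : Indecomposable X
  · exact ⟨⟨Unit, fun _ => X, fun _ => hX, fun _ => 𝟙 X, fun _ => 𝟙 X, by simp⟩⟩
  obtain ⟨Y, Z, e, hY, hZ⟩ : ∃ (Y Z : C) (_ : X ≅ Y ⊞ Z), ¬IsZero Y ∧ ¬IsZero Z := by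
    simpa [Indecomposable, h0] using hX
  -- a proper retract has a smaller endomorphism ring: a splitting embeds it in `End X`,
  -- and the identity of `X` is not in the image
  have key {T R : C} (i : T ⟶ X) (p : X ⟶ T) (hip : i ≫ p = 𝟙 T) (j : R ⟶ X)
      (hjp : j ≫ p = 0) (hj : j ≠ 0) : Module.finrank k (T ⟶ T) < n := by
    let φ : (T ⟶ T) →ₗ[k] (X ⟶ X) := (Linear.leftComp k X p).comp (Linear.rightComp k T i)
    have hφ (f : T ⟶ T) : φ f = p ≫ f ≫ i := rfl
    have hinj : Function.Injective φ := fun f g hfg => by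
      rw [hφ, hφ] at hfg
      have := i ≫= hfg =≫ p
      simpa [hip, reassoc_of% hip] using this
    rw [← h, ← LinearMap.finrank_range_of_inj hinj]
    refine Submodule.finrank_lt fun htop => hj ?_
    obtain ⟨f, hf⟩ := (LinearMap.range_eq_top.1 htop) (𝟙 X)
    rw [← Category.comp_id j, ← hf, hφ, reassoc_of% hjp, zero_comp]
  have h1 : (biprod.inl : Y ⟶ Y ⊞ Z) ≫ e.inv ≠ 0 := fun h => hY <| by
    rw [IsZero.iff_id_eq_zero, ← biprod.inl_fst (X := Y) (Y := Z),
      (Preadditive.IsIso.comp_right_eq_zero _ _).1 h, zero_comp]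
  have h2 : (biprod.inr : Z ⟶ Y ⊞ Z) ≫ e.inv ≠ 0 := fun h => hZ <| by
    rw [IsZero.iff_id_eq_zero, ← biprod.inr_snd (X := Y) (Y := Z),
      (Preadditive.IsIso.comp_right_eq_zero _ _).1 h, zero_comp]
  obtain ⟨D⟩ := ih _ (key (biprod.inl ≫ e.inv) (e.hom ≫ biprod.fst) (by simp)
    (biprod.inr ≫ e.inv) (by simp) h2) Y rfl
  obtain ⟨D'⟩ := ih _ (key (biprod.inr ≫ e.inv) (e.hom ≫ biprod.snd) (by simp)
    (biprod.inl ≫ e.inv) (by simp) h1) Z rfl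
  refine ⟨⟨D.J ⊕ D'.J, Sum.elim D.obj D'.obj, fun j => ?_,
    fun j => match j with
      | .inl j => D.ι j ≫ biprod.inl ≫ e.inv
      | .inr j => D'.ι j ≫ biprod.inr ≫ e.inv,
    fun j => match j with
      | .inl j => e.hom ≫ biprod.fst ≫ D.π j
      | .inr j => e.hom ≫ biprod.snd ≫ D'.π j, ?_⟩⟩
  · rcases j with j | j
    · exact D.indec j
    · exact D'.indec j
  · have a1 : ∑ j, (e.hom ≫ biprod.fst ≫ D.π j) ≫ D.ι j ≫ biprod.inl ≫ e.inv =
        e.hom ≫ biprod.fst ≫ (∑ j, D.π j ≫ D.ι j) ≫ biprod.inl ≫ e.inv := by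
      simp [Preadditive.comp_sum, Preadditive.sum_comp]
    have a2 : ∑ j, (e.hom ≫ biprod.snd ≫ D'.π j) ≫ D'.ι j ≫ biprod.inr ≫ e.inv =
        e.hom ≫ biprod.snd ≫ (∑ j, D'.π j ≫ D'.ι j) ≫ biprod.inr ≫ e.inv := by
      simp [Preadditive.comp_sum, Preadditive.sum_comp]
    rw [Fintype.sum_sum_type]
    refine (congrArg₂ (· + ·) a1 a2).trans ?_
    rw [D.total, D'.total]
    have : e.hom ≫ (biprod.fst ≫ biprod.inl + biprod.snd ≫ biprod.inr) ≫ e.inv = 𝟙 X := by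
      rw [biprod.total]; simp
    simpa [-biprod.total] using this

end Indecomposable

/-! ### Exactness and faithfulness of the tensor product -/

section Tensor

variable {C : Type u} [Category.{v} C] [MonoidalCategory C]

instance preservesColimits_tensorLeft [RightRigidCategory C] [LeftRigidCategory C] (X : C) :
    PreservesColimitsOfSize.{0, 0} (tensorLeft X) :=
  (tensorLeftAdjunction (ᘁX) X).leftAdjoint_preservesColimits

instance preservesColimits_tensorRight [RightRigidCategory C] [LeftRigidCategory C] (X : C) :
    PreservesColimitsOfSize.{0, 0} (tensorRight X) :=
  (tensorRightAdjunction X (Xᘁ)).leftAdjoint_preservesColimits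

instance preservesLimits_tensorLeft [RightRigidCategory C] [LeftRigidCategory C] (X : C) :
    PreservesLimitsOfSize.{0, 0} (tensorLeft X) :=
  (tensorLeftAdjunction X (Xᘁ)).rightAdjoint_preservesLimits

instance preservesLimits_tensorRight [RightRigidCategory C] [LeftRigidCategory C] (X : C) :
    PreservesLimitsOfSize.{0, 0} (tensorRight X) :=
  (tensorRightAdjunction (ᘁX) X).rightAdjoint_preservesLimits

variable [RigidCategory C]

instance mono_whiskerLeft (X : C) {Y Z : C} (f : Y ⟶ Z) [Mono f] : Mono (X ◁ f) :=
  inferInstanceAs (Mono ((tensorLeft X).map f))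

instance mono_whiskerRight (X : C) {Y Z : C} (f : Y ⟶ Z) [Mono f] : Mono (f ▷ X) :=
  inferInstanceAs (Mono ((tensorRight X).map f))

instance epi_whiskerLeft (X : C) {Y Z : C} (f : Y ⟶ Z) [Epi f] : Epi (X ◁ f) :=
  inferInstanceAs (Epi ((tensorLeft X).map f))

instance epi_whiskerRight (X : C) {Y Z : C} (f : Y ⟶ Z) [Epi f] : Epi (f ▷ X) :=
  inferInstanceAs (Epi ((tensorRight X).map f))

variable [Abelian C] [MonoidalPreadditive C]

/-- If the unit object is simple, the coevaluation of a nonzero object `X` is a monomorphism, and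
stays one after tensoring with `Y`, so that `Y` embeds into `ᘁX ⊗ (X ⊗ Y)`. -/
theorem isZero_of_isZero_tensor [Simple (𝟙_ C)] {X Y : C} (h : IsZero (X ⊗ Y)) (hX : ¬IsZero X) :
    IsZero Y := by
  have hη : η_ (ᘁX) X ≠ 0 := fun h0 => hX <| by
    rw [IsZero.iff_id_eq_zero]
    have h1 := ExactPairing.coevaluation_evaluation (ᘁX) X
    rw [h0, MonoidalPreadditive.whiskerLeft_zero, zero_comp] at h1
    have h2 := (ρ_ X).inv ≫= h1 =≫ (λ_ X).hom
    simpa using h2.symm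
  have : Mono (η_ (ᘁX) X) := mono_of_nonzero_from_simple hη
  have hz : IsZero ((ᘁX) ⊗ (X ⊗ Y)) := (tensorLeft (ᘁX)).map_isZero h
  rw [IsZero.iff_id_eq_zero, ← cancel_mono ((λ_ Y).inv ≫ η_ (ᘁX) X ▷ Y ≫ (α_ _ _ _).hom)]
  exact hz.eq_of_tgt _ _

/-- The tensor product of the image factorizations of `f` and `g` factors `f ⊗ₘ g` as an epimorphism
followed by a monomorphism, through the tensor product of the images. -/
theorem tensorHom_ne_zero [Simple (𝟙_ C)] {X X' Y Y' : C} {f : X ⟶ X'} {g : Y ⟶ Y'} (hf : f ≠ 0)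
    (hg : g ≠ 0) : f ⊗ₘ g ≠ 0 := by
  intro h
  have hI : ¬IsZero (Limits.image f) := fun hz => hf <| by
    rw [← Limits.image.fac f, hz.eq_of_tgt (factorThruImage f) 0, zero_comp]
  have hJ : ¬IsZero (Limits.image g) := fun hz => hg <| by
    rw [← Limits.image.fac g, hz.eq_of_tgt (factorThruImage g) 0, zero_comp]
  refine hJ (isZero_of_isZero_tensor ?_ hI)
  rw [← Limits.image.fac f, ← Limits.image.fac g, ← tensorHom_comp_tensorHom,
    tensorHom_def (factorThruImage f), tensorHom_def (Limits.image.ι f)] at h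
  exact IsZero.of_mono_eq_zero _ (zero_of_comp_mono _ (zero_of_epi_comp _ h))

end Tensor

/-! ### Natural endomorphisms of the identity functor -/

section Component

variable {C : Type u} [Category.{v} C]

/-- The component at `X` of a natural endomorphism of the identity functor, with the type
`X ⟶ X` in place of `(𝟭 C).obj X ⟶ (𝟭 C).obj X`. -/
def component (g : 𝟭 C ⟶ 𝟭 C) (X : C) : X ⟶ X := g.app X

theorem component_comp (g : 𝟭 C ⟶ 𝟭 C) {X Y : C} (f : X ⟶ Y) :
    component g X ≫ f = f ≫ component g Y := (g.naturality f).symm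

variable {k : Type w} [Field k] [Abelian C] [Linear k C]

theorem component_eq_smul_of_mono {g : 𝟭 C ⟶ 𝟭 C} {c : k} {X Y : C} (f : X ⟶ Y) [Mono f]
    (h : component g Y = c • 𝟙 Y) : component g X = c • 𝟙 X := by
  rw [← cancel_mono f, component_comp, h]
  simp

theorem component_eq_smul_of_epi {g : 𝟭 C ⟶ 𝟭 C} {c : k} {X Y : C} (f : X ⟶ Y) [Epi f]
    (h : component g X = c • 𝟙 X) : component g Y = c • 𝟙 Y := by
  rw [← cancel_epi f, ← component_comp, h]
  simp

theorem smul_id_injective (k : Type w) [Field k] [Linear k C] {X : C} (h : ¬IsZero X) :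
    Function.Injective fun c : k => c • 𝟙 X :=
  smul_left_injective k fun h' => h ((IsZero.iff_id_eq_zero X).2 h')

/-- A natural endomorphism of the identity functor acting by the scalar `c` on the ends of a short
exact sequence acts on the middle by `c` up to an error of square zero. This holds also after the
application of a right exact functor to the sequence. -/
theorem component_sub_smul_sq_eq_zero {g : 𝟭 C ⟶ 𝟭 C} {c : k} (F : C ⥤ C)
    [F.PreservesZeroMorphisms] [PreservesColimitsOfShape WalkingParallelPair F] {Y Z : C}
    (i : Y ⟶ Z) (hY : component g (F.obj Y) = c • 𝟙 _)
    (hQ : component g (F.obj (cokernel i)) = c • 𝟙 _) :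
    (component g (F.obj Z) - c • 𝟙 _) ≫ (component g (F.obj Z) - c • 𝟙 _) = 0 := by
  refine comp_eq_zero_of_map_cokernel F i ?_ ?_
  · rw [Preadditive.sub_comp, component_comp, hQ]
    simp
  · rw [Preadditive.comp_sub, ← component_comp, hY]
    simp

end Component

/-! ### Natural automorphisms from functions on blocks -/

section BlockEnd

variable {k : Type w} [Field k] {C : Type u} [Category.{v} C] [Abelian C] [Linear k C]

/-- The endomorphism of `X` which is the scalar `wt Z` on each summand `Z` of a decomposition. -/
noncomputable def IndecDecomp.scalarEnd {X : C} (D : IndecDecomp X) (wt : C → k) : X ⟶ X :=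
  ∑ j, wt (D.obj j) • (D.π j ≫ D.ι j)

/-- If scalars agree on indecomposable objects with a nonzero morphism between them, the
endomorphisms given by decompositions commute with all morphisms. With the identity for `f`, they
do not depend on the decomposition. -/
theorem IndecDecomp.scalarEnd_comp {X Y : C} (D : IndecDecomp X) (D' : IndecDecomp Y) {wt : C → k}
    (hwt : ∀ X Y : C, Indecomposable X → Indecomposable Y → ∀ f : X ⟶ Y, f ≠ 0 → wt X = wt Y)
    (f : X ⟶ Y) : D.scalarEnd wt ≫ f = f ≫ D'.scalarEnd wt := by
  have h1 : D.scalarEnd wt ≫ f =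
      ∑ j, ∑ l, wt (D.obj j) • (D.π j ≫ (D.ι j ≫ f ≫ D'.π l) ≫ D'.ι l) := by
    have : D.scalarEnd wt ≫ f = D.scalarEnd wt ≫ f ≫ ∑ l, D'.π l ≫ D'.ι l := by
      rw [D'.total, Category.comp_id]
    rw [this]
    simp [scalarEnd, Preadditive.comp_sum, Preadditive.sum_comp]
    exact Finset.sum_comm
  have h2 : f ≫ D'.scalarEnd wt =
      ∑ j, ∑ l, wt (D'.obj l) • (D.π j ≫ (D.ι j ≫ f ≫ D'.π l) ≫ D'.ι l) := by
    have : f ≫ D'.scalarEnd wt = (∑ j, D.π j ≫ D.ι j) ≫ f ≫ D'.scalarEnd wt := by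
      rw [D.total, Category.id_comp]
    rw [this]
    simp only [scalarEnd, Preadditive.comp_sum, Preadditive.sum_comp, Linear.comp_smul,
      Finset.smul_sum, Category.assoc]
    exact Finset.sum_comm
  rw [h1, h2]
  refine Finset.sum_congr rfl fun j _ => Finset.sum_congr rfl fun l _ => ?_
  by_cases h : D.ι j ≫ f ≫ D'.π l = 0
  · simp [h]
  · rw [hwt _ _ (D.indec j) (D'.indec l) _ h]

/-- The natural endomorphism of the identity functor acting on each indecomposable object `Z` by
the scalar `wt Z`. -/
noncomputable def blockEnd (D : ∀ X : C, IndecDecomp X) {wt : C → k}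
    (hwt : ∀ X Y : C, Indecomposable X → Indecomposable Y → ∀ f : X ⟶ Y, f ≠ 0 → wt X = wt Y) :
    𝟭 C ⟶ 𝟭 C where
  app X := (D X).scalarEnd wt
  naturality _ _ f := ((D _).scalarEnd_comp (D _) hwt f).symm

variable (D : ∀ X : C, IndecDecomp X) {wt : C → k}
  (hwt : ∀ X Y : C, Indecomposable X → Indecomposable Y → ∀ f : X ⟶ Y, f ≠ 0 → wt X = wt Y)

theorem component_blockEnd_of_indecomposable {X : C} (hX : Indecomposable X) :
    component (blockEnd D hwt) X = wt X • 𝟙 X := by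
  let D' : IndecDecomp X := ⟨Unit, fun _ => X, fun _ => hX, fun _ => 𝟙 X, fun _ => 𝟙 X, by simp⟩
  have := (D X).scalarEnd_comp D' hwt (𝟙 X)
  rw [Category.comp_id, Category.id_comp] at this
  refine this.trans ?_
  simp [IndecDecomp.scalarEnd, D']

theorem comp_component_blockEnd {X : C} (j : (D X).J) :
    (D X).ι j ≫ component (blockEnd D hwt) X = wt ((D X).obj j) • (D X).ι j := by
  rw [← component_comp, component_blockEnd_of_indecomposable D hwt ((D X).indec j)]
  simp

/-- The endomorphism `blockEnd` is semisimple: it has no nilpotent part. -/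
theorem component_blockEnd_eq_smul_of_sq_eq_zero {X : C} {c : k}
    (h : (component (blockEnd D hwt) X - c • 𝟙 X) ≫ (component (blockEnd D hwt) X - c • 𝟙 X) = 0) :
    component (blockEnd D hwt) X = c • 𝟙 X := by
  rw [← sub_eq_zero]
  set φ := component (blockEnd D hwt) X - c • 𝟙 X with hφ
  have key : ∀ j, (D X).ι j ≫ φ = (wt ((D X).obj j) - c) • (D X).ι j := fun j => by
    rw [hφ, Preadditive.comp_sub, comp_component_blockEnd, sub_smul]
    simp
  rw [← Category.id_comp φ, ← (D X).total, Preadditive.sum_comp]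
  refine Finset.sum_eq_zero fun j _ => ?_
  have h2 := (D X).ι j ≫= h
  rw [comp_zero, ← Category.assoc, key, Linear.smul_comp, key, smul_smul] at h2
  rw [Category.assoc, key]
  rcases smul_eq_zero.1 h2 with h2 | h2
  · rw [mul_self_eq_zero.1 h2, zero_smul, comp_zero]
  · rw [h2, smul_zero, comp_zero]

/-- The inverse is given by the inverse scalars. -/
theorem isIso_component_blockEnd (h0 : ∀ X, wt X ≠ 0) (X : C) :
    IsIso (component (blockEnd D hwt) X) := by
  have hwt' : ∀ X Y : C, Indecomposable X → Indecomposable Y → ∀ f : X ⟶ Y, f ≠ 0 →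
      (fun X => (wt X)⁻¹) X = (fun X => (wt X)⁻¹) Y := fun X Y hX hY f hf => by
    simp only [hwt X Y hX hY f hf]
  have h1 : component (blockEnd D hwt) X ≫ component (blockEnd D hwt') X = 𝟙 X := by
    rw [← Category.id_comp (component (blockEnd D hwt) X ≫ _), ← (D X).total,
      Preadditive.sum_comp]
    refine Finset.sum_congr rfl fun j _ => ?_
    rw [Category.assoc, ← Category.assoc ((D X).ι j), comp_component_blockEnd, Linear.smul_comp,
      comp_component_blockEnd, smul_smul, mul_inv_cancel₀ (h0 _), one_smul]
  exact ⟨_, h1, (component_comp _ _).symm.trans h1⟩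

end BlockEnd

/-! ### Monoidality of semisimple natural endomorphisms -/

section Monoidal

variable {k : Type w} [Field k] {C : Type u} [Category.{v} C] [Abelian C] [Linear k C]
  [MonoidalCategory C] [MonoidalPreadditive C]

/-- Multiplicativity of the scalars on `X ⊗ Y` follows from the case of simple objects by dévissage
in each variable, if the natural endomorphism `g` is semisimple. -/
theorem component_tensor_eq_smul [RigidCategory C] {g : 𝟭 C ⟶ 𝟭 C} (hC : ∀ X : C, HasFiniteLength X)
    (hss : ∀ (X : C) (c : k), (component g X - c • 𝟙 X) ≫ (component g X - c • 𝟙 X) = 0 →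
      component g X = c • 𝟙 X)
    (hsimple : ∀ X Y : C, Simple X → Simple Y → ∀ a b : k, component g X = a • 𝟙 X →
      component g Y = b • 𝟙 Y → component g (X ⊗ Y) = (a * b) • 𝟙 (X ⊗ Y))
    {X Y : C} {a b : k} (hX : component g X = a • 𝟙 X) (hY : component g Y = b • 𝟙 Y) :
    component g (X ⊗ Y) = (a * b) • 𝟙 (X ⊗ Y) := by
  revert hY
  refine (hC Y).induction (P := fun Y => component g Y = b • 𝟙 Y →
    component g (X ⊗ Y) = (a * b) • 𝟙 (X ⊗ Y)) ?_ ?_ ?_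
  · intro Z hZ _
    exact ((tensorLeft X).map_isZero hZ).eq_of_src _ _
  · intro Y Z i _ hY hQ hZ
    exact hss _ _ (component_sub_smul_sq_eq_zero (tensorLeft X) i
      (hY (component_eq_smul_of_mono i hZ)) (hQ (component_eq_smul_of_epi (cokernel.π i) hZ)))
  · intro Y hYs hY
    revert hX
    refine (hC X).induction (P := fun X => component g X = a • 𝟙 X →
      component g (X ⊗ Y) = (a * b) • 𝟙 (X ⊗ Y)) ?_ ?_ ?_
    · intro Z hZ _
      exact ((tensorRight Y).map_isZero hZ).eq_of_src _ _
    · intro X Z i _ hX hQ hZ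
      exact hss _ _ (component_sub_smul_sq_eq_zero (tensorRight Y) i
        (hX (component_eq_smul_of_mono i hZ)) (hQ (component_eq_smul_of_epi (cokernel.π i) hZ)))
    · intro X hXs hX
      exact hsimple X Y hXs hYs a b hX hY

/-- If `blockEnd` is multiplicative on pairs of objects where it acts by scalars, it is monoidal:
both sides are determined on the summands of decompositions of `X` and `Y`. -/
theorem component_blockEnd_tensor [MonoidalLinear k C] (D : ∀ X : C, IndecDecomp X) {wt : C → k}
    (hwt : ∀ X Y : C, Indecomposable X → Indecomposable Y → ∀ f : X ⟶ Y, f ≠ 0 → wt X = wt Y)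
    (h : ∀ (X Y : C) (a b : k), component (blockEnd D hwt) X = a • 𝟙 X →
      component (blockEnd D hwt) Y = b • 𝟙 Y →
      component (blockEnd D hwt) (X ⊗ Y) = (a * b) • 𝟙 (X ⊗ Y)) (X Y : C) :
    component (blockEnd D hwt) (X ⊗ Y) =
      component (blockEnd D hwt) X ⊗ₘ component (blockEnd D hwt) Y := by
  have hid : ∑ j, ∑ l, ((D X).π j ⊗ₘ (D Y).π l) ≫ ((D X).ι j ⊗ₘ (D Y).ι l) = 𝟙 (X ⊗ Y) := by
    simp only [tensorHom_comp_tensorHom, ← tensor_sum, ← sum_tensor, (D X).total, (D Y).total,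
      id_tensorHom_id]
  rw [← Category.id_comp (component (blockEnd D hwt) (X ⊗ Y)),
    ← Category.id_comp (component (blockEnd D hwt) X ⊗ₘ component (blockEnd D hwt) Y), ← hid]
  simp only [Preadditive.sum_comp]
  refine Finset.sum_congr rfl fun j _ => Finset.sum_congr rfl fun l _ => ?_
  rw [Category.assoc, Category.assoc, ← component_comp, tensorHom_comp_tensorHom,
    comp_component_blockEnd, comp_component_blockEnd,
    h _ _ _ _ (component_blockEnd_of_indecomposable D hwt ((D X).indec j))
      (component_blockEnd_of_indecomposable D hwt ((D Y).indec l))]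
  simp [MonoidalCategory.tensorHom_def, smul_smul, mul_comm]

end Monoidal

/-! ### Unipotent monoidal automorphisms -/

section Nilpotent

variable {C : Type u} [Category.{v} C]

theorem component_pow (ν : End (𝟭 C)) (n : ℕ) (X : C) :
    component (ν ^ n : End (𝟭 C)) X = (show End X from component ν X) ^ n := by
  induction n with
  | zero => rfl
  | succ n ih =>
    rw [pow_succ, pow_succ, ← ih]
    rfl

variable [Abelian C]

theorem component_zero (X : C) : component (0 : End (𝟭 C)) X = 0 := NatTrans.app_zero (F := 𝟭 C) X

/-- The regular module generates the category of finitely generated modules, so a natural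
endomorphism of the identity functor of a finite category vanishes if it does so at one object. -/
theorem IsFiniteAbelian.exists_component_eq_zero_imp {k : Type w} [Field k] [Linear k C]
    (h : IsFiniteAbelian k C) :
    ∃ P : C, ∀ ν : End (𝟭 C), component ν P = 0 → ν = 0 := by
  obtain ⟨A, _, _, E, _, _, _⟩ := h
  refine ⟨E.inverse.obj (FGModuleCat.of A A), fun ν hν => ?_⟩
  ext X
  change component ν X = 0
  refine E.functor.map_injective ?_
  rw [Functor.map_zero]
  ext x
  let f : FGModuleCat.of A A ⟶ E.functor.obj X :=
    FGModuleCat.ofHom (LinearMap.toSpanSingleton A (E.functor.obj X) x)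
  let u : E.inverse.obj (E.functor.obj X) ⟶ X := E.unitInv.app X
  have hu : E.inverse.map (E.functor.map (component ν X)) ≫ u = u ≫ component ν X :=
    E.unitInv.naturality (component ν X)
  have hIso : IsIso u := inferInstanceAs (IsIso (E.unitInv.app X))
  have h1 : E.inverse.map (f ≫ E.functor.map (component ν X)) = 0 := by
    rw [Functor.map_comp, ← cancel_mono u, Category.assoc, hu, ← Category.assoc,
      ← component_comp ν, hν, zero_comp, zero_comp]
  have h3 : f ≫ E.functor.map (component ν X) = 0 := E.inverse.map_injective (by simpa using h1)
  have h4 := congrArg (fun φ : FGModuleCat.of A A ⟶ E.functor.obj X => φ.hom.hom (1 : A)) h3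
  have h5 : f.hom.hom (1 : A) = x := one_smul A x
  change (E.functor.map (component ν X)).hom.hom (f.hom.hom (1 : A)) = 0 at h4
  rwa [h5] at h4

/-- A natural endomorphism of the identity functor killing all simple objects is nilpotent on each
object of finite length. -/
theorem isNilpotent_component {ν : End (𝟭 C)} {X : C} (hX : HasFiniteLength X)
    (h : ∀ Z : C, Simple Z → component ν Z = 0) : ∃ n, component (ν ^ n : End (𝟭 C)) X = 0 := by
  refine hX.induction (P := fun X => ∃ n, component (ν ^ n : End (𝟭 C)) X = 0)
    (fun Z hZ => ⟨0, hZ.eq_of_src _ _⟩) ?_ fun Z hZ => ⟨1, by rw [pow_one, h Z hZ]⟩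
  rintro Y Z i _ ⟨a, ha⟩ ⟨b, hb⟩
  refine ⟨a + b, ?_⟩
  rw [pow_add]
  change component (ν ^ b : End (𝟭 C)) Z ≫ component (ν ^ a : End (𝟭 C)) Z = 0
  refine comp_eq_zero_of_map_cokernel (𝟭 C) i ?_ ?_
  · exact (component_comp (ν ^ b : End (𝟭 C)) (cokernel.π i)).trans (by rw [hb, comp_zero])
  · exact (component_comp (ν ^ a : End (𝟭 C)) i).symm.trans (by rw [ha, zero_comp])

end Nilpotent

section Unipotent

variable {C : Type u} [Category.{v} C] [Abelian C] [MonoidalCategory C] [RigidCategory C]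
  [MonoidalPreadditive C]

/-- The growth of nilpotency: if `g` is monoidal and `g - 1` has nilpotency index `n + 1`, then
`(g - 1) ^ (2 * n)` does not vanish on `X ⊗ X` for an object `X` with `(g - 1) ^ n` nonzero. -/
theorem pow_two_mul_ne_zero (k : Type w) [Field k] [CharZero k] [Linear k C]
    [Simple (𝟙_ C)] {ν : End (𝟭 C)}
    (hν : ∀ X Y : C, 𝟙 (X ⊗ Y) + component ν (X ⊗ Y) =
      (𝟙 X + component ν X) ⊗ₘ (𝟙 Y + component ν Y))
    {n : ℕ} (h : ν ^ n ≠ 0) (h' : ν ^ (n + 1) = 0) : ν ^ (2 * n) ≠ 0 := by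
  obtain ⟨X, hX⟩ : ∃ X : C, component (ν ^ n : End (𝟭 C)) X ≠ 0 := by
    by_contra! hX
    exact h (NatTrans.ext (funext fun X => (hX X).trans (component_zero X).symm))
  let x : End X := component ν X
  let a : End (X ⊗ X) := (tensorRight X).mapEnd X x
  let b : End (X ⊗ X) := (tensorLeft X).mapEnd X x
  have hpow : x ^ (n + 1) = 0 := by
    exact (component_pow ν (n + 1) X).symm.trans (by rw [h', component_zero])
  have ha : a ^ (n + 1) = 0 := by
    rw [← map_pow, hpow]
    exact (tensorRight X).map_zero _ _
  have hb : b ^ (n + 1) = 0 := by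
    rw [← map_pow, hpow]
    exact (tensorLeft X).map_zero _ _
  have hab : Commute a b := (whisker_exchange x x).trans rfl
  have hne : a ^ n * b ^ n ≠ 0 := by
    rw [(hab.pow_pow n n).eq, ← map_pow, ← map_pow, ← component_pow]
    exact (MonoidalCategory.tensorHom_def _ _).symm.trans_ne (tensorHom_ne_zero hX hX)
  have hx : component ν (X ⊗ X) = ((1 + a) * (1 + b) - 1 : End (X ⊗ X)) := by
    refine eq_sub_of_add_eq' ((hν X X).trans ?_)
    rw [MonoidalCategory.tensorHom_def', MonoidalPreadditive.whiskerLeft_add,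
      MonoidalPreadditive.add_whiskerRight, MonoidalCategory.whiskerLeft_id, id_whiskerRight]
    rfl
  intro h0
  refine hab.one_add_mul_one_add_sub_one_pow_ne_zero k ha hb hne ?_
  rw [← hx]
  exact (component_pow ν (2 * n) (X ⊗ X)).symm.trans (by rw [h0, component_zero])

/-- In characteristic zero a finite tensor category has no nontrivial unipotent monoidal
automorphism of the identity functor. -/
theorem eq_id_of_component_simple_eq_id (k : Type w) [Field k] [CharZero k] [Linear k C]
    [MonoidalLinear k C] [IsTensorCategory k C] (hfin : IsFiniteAbelian k C) {g : 𝟭 C ⟶ 𝟭 C}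
    (hg : ∀ X Y : C, component g (X ⊗ Y) = component g X ⊗ₘ component g Y)
    (h : ∀ Z : C, Simple Z → component g Z = 𝟙 Z) : g = 𝟙 (𝟭 C) := by
  have := IsTensorCategory.simple_unit k (C := C)
  let ν : End (𝟭 C) := g - 𝟙 (𝟭 C)
  have hν (X : C) : 𝟙 X + component ν X = component g X := add_sub_cancel (𝟙 X) (component g X)
  have hnil : ∃ n, ν ^ n = 0 := by
    obtain ⟨P, hP⟩ := hfin.exists_component_eq_zero_imp
    obtain ⟨n, hn⟩ := isNilpotent_component (ν := ν) (IsTensorCategory.finite_length k P)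
      fun Z hZ => by
        have := hν Z
        rwa [h Z hZ, add_eq_left] at this
    exact ⟨n, hP _ hn⟩
  have h0 : ν ^ 1 = 0 := by
    classical
    obtain ⟨n, hn⟩ : ∃ n, Nat.find hnil = n := ⟨_, rfl⟩
    have hspec := Nat.find_spec hnil
    rw [hn] at hspec
    -- the index is `0`, `1` or `n + 2`, and the last is impossible as `n + 2 ≤ 2 * (n + 1)`
    rcases n with _ | _ | n
    · exact pow_eq_zero_of_le (Nat.zero_le _) hspec
    · exact hspec
    · have hmin : ν ^ (n + 1) ≠ 0 := Nat.find_min hnil (by omega)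
      refine absurd (pow_eq_zero_of_le (by omega) hspec)
        (pow_two_mul_ne_zero k (fun X Y => ?_) hmin hspec)
      rw [hν, hν, hν, hg]
  rw [pow_one] at h0
  exact sub_eq_zero.1 h0

end Unipotent

/-! ### The scalars of a natural automorphism -/

section Scalars

variable {C : Type u} [Category.{v} C] [Abelian C] {k : Type w} [Field k] [Linear k C]

/-- Between two objects on which a natural endomorphism has different generalized eigenvalues there
is no nonzero morphism. -/
theorem eq_of_isNilpotent_component_sub {g : 𝟭 C ⟶ 𝟭 C} {X Y : C} {c d : k}
    (hX : IsNilpotent (show End X from component g X - c • 𝟙 X))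
    (hY : IsNilpotent (show End Y from component g Y - d • 𝟙 Y)) {f : X ⟶ Y} (hf : f ≠ 0) :
    c = d := by
  by_contra hcd
  obtain ⟨n, hn⟩ := hY
  -- a power of `g - d` vanishes at `Y`, but is invertible at `X`
  let ν : End (𝟭 C) := g - d • 𝟙 (𝟭 C)
  have hνX : IsUnit (show End X from component ν X) := by
    have h1 : IsUnit ((c - d) • (1 : End X)) := by
      rw [← Algebra.algebraMap_eq_smul_one]
      exact (IsUnit.mk0 (c - d) (sub_ne_zero.2 hcd)).map (algebraMap k (End X))
    have h2 := hX.isUnit_add_left_of_commute h1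
      ((Commute.one_right _).smul_right (c - d))
    have h3 : component ν X = c • 𝟙 X - d • 𝟙 X + (component g X - c • 𝟙 X) := by
      change component g X - d • 𝟙 X = _
      abel
    rw [← sub_smul] at h3
    exact h3 ▸ h2
  have hνY : component (ν ^ n : End (𝟭 C)) Y = 0 := (component_pow ν n Y).trans hn
  have hiso : IsIso (component (ν ^ n : End (𝟭 C)) X) := by
    rw [component_pow]
    exact (isUnit_iff_isIso _).1 (hνX.pow n)
  refine hf ((Preadditive.IsIso.comp_left_eq_zero (component (ν ^ n : End (𝟭 C)) X) f).1 ?_)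
  rw [component_comp (ν ^ n : End (𝟭 C)), hνY, comp_zero]

/-- A natural endomorphism acting by scalars on two objects of the same block acts by the same
scalar: each object of a chain joining them has a single generalized eigenvalue, which nonzero
morphisms preserve. -/
theorem eq_of_sameBlock [IsAlgClosed k] [∀ X Y : C, Module.Finite k (X ⟶ Y)] {g : 𝟭 C ⟶ 𝟭 C}
    {X Y : {X : C // Indecomposable X}} (h : SameBlock X Y) {c d : k}
    (hX : component g X.1 = c • 𝟙 X.1) (hY : component g Y.1 = d • 𝟙 Y.1) : c = d := by
  choose e he using fun Z : {X : C // Indecomposable X} =>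
    Z.2.exists_isNilpotent_sub_smul_id k (component g Z.1)
  have hnil {Z : {X : C // Indecomposable X}} {a : k} (hZ : component g Z.1 = a • 𝟙 Z.1) :
      e Z = a := by
    refine eq_of_isNilpotent_component_sub (he Z) (Y := Z.1) (d := a) ?_ (f := 𝟙 Z.1)
      fun h0 => Z.2.1 ((IsZero.iff_id_eq_zero Z.1).2 h0)
    rw [hZ, sub_self]
    exact IsNilpotent.zero
  have hblock : e X = e Y := by
    clear hX hY
    induction h with
    | rel Z W h =>
      obtain ⟨f, hf⟩ := h
      exact eq_of_isNilpotent_component_sub (he Z) (he W) hf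
    | refl => rfl
    | symm Z W _ ih => exact ih.symm
    | trans Z W V _ _ ih1 ih2 => exact ih1.trans ih2
  rw [← hnil hX, ← hnil hY, hblock]

theorem CompSeries.component_factor_eq_smul {g : 𝟭 C ⟶ 𝟭 C} {X : C} (s : CompSeries X)
    (j : Fin s.length) {c : k} (h : component g X = c • 𝟙 X) :
    component g (s.factor j) = c • 𝟙 (s.factor j) := by
  change component g (cokernel (Subobject.ofLE _ _ (s.step j))) = c • 𝟙 (cokernel _)
  exact component_eq_smul_of_epi (cokernel.π (Subobject.ofLE _ _ (s.step j)))
    (component_eq_smul_of_mono (s.sub j.succ).arrow h)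

theorem exists_component_eq_units_smul [IsAlgClosed k] [∀ X Y : C, Module.Finite k (X ⟶ Y)]
    (g : Aut (𝟭 C)) (X : C) [Simple X] : ∃ c : kˣ, component g.hom X = (c : k) • 𝟙 X := by
  obtain ⟨c, hc⟩ := endomorphism_simple_eq_smul_id k (component g.hom X)
  have hiso : IsIso (component g.hom X) := ((show 𝟭 C ≅ 𝟭 C from g).app X).isIso_hom
  refine ⟨Units.mk0 c fun h0 => Simple.not_isZero X ?_, hc.symm⟩
  rw [h0, zero_smul] at hc
  exact IsZero.of_mono_eq_zero _ hc.symm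

theorem nonempty_iso_of_simple {S : SimpleClass C → {X : C // Simple X}}
    (hS : ∀ i, SimpleClass.mk C (S i) = i) (X : C) (hX : Simple X) :
    ∃ i, Nonempty ((S i).1 ≅ X) :=
  ⟨SimpleClass.mk C ⟨X, hX⟩, Quotient.exact (hS (SimpleClass.mk C ⟨X, hX⟩))⟩

end Scalars

section TensorAut

variable {C : Type u} [Category.{v} C] [MonoidalCategory C]

theorem component_tensor (g : tensorAutId C) (X Y : C) :
    component (g : Aut (𝟭 C)).hom (X ⊗ Y) =
      component (g : Aut (𝟭 C)).hom X ⊗ₘ component (g : Aut (𝟭 C)).hom Y := by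
  have : NatTrans.IsMonoidal (g : Aut (𝟭 C)).hom := g.2
  have h := NatTrans.IsMonoidal.tensor (τ := (g : Aut (𝟭 C)).hom) X Y
  exact (Category.id_comp _).symm.trans (h.trans (Category.comp_id _))

theorem mem_tensorAutId {g : Aut (𝟭 C)} (h1 : component g.hom (𝟙_ C) = 𝟙 _)
    (h : ∀ X Y : C, component g.hom (X ⊗ Y) = component g.hom X ⊗ₘ component g.hom Y) :
    g ∈ tensorAutId C :=
  { unit := (Category.id_comp _).trans h1
    tensor := fun X Y => (Category.id_comp _).trans ((h X Y).trans (Category.comp_id _).symm) }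

variable {k : Type w} [Field k] [Abelian C] [Linear k C] [MonoidalPreadditive C]
  [MonoidalLinear k C]

theorem smul_id_tensor_smul_id (X Y : C) (a b : k) :
    (a • 𝟙 X) ⊗ₘ (b • 𝟙 Y) = (a * b) • 𝟙 (X ⊗ Y) := by
  simp [MonoidalCategory.tensorHom_def, smul_smul, mul_comm]

end TensorAut

/-! ### The isomorphism -/

section Main

variable {k : Type w} [Field k] [IsAlgClosed k] {C : Type u} [Category.{v} C] [Abelian C]
  [Linear k C] [MonoidalCategory C] [MonoidalPreadditive C] [MonoidalLinear k C]
  {S : SimpleClass C → {X : C // Simple X}}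

theorem mem_fusionFunctions [∀ X Y : C, Module.Finite k (X ⟶ Y)] (g : tensorAutId C)
    {l : SimpleClass C → kˣ}
    (hl : ∀ i, component (g : Aut (𝟭 C)).hom (S i).1 = (l i : k) • 𝟙 (S i).1) :
    l ∈ fusionFunctions k S := by
  refine ⟨fun i j m hm => ?_, fun i j hij => Units.ext (eq_of_sameBlock hij (hl i) (hl j))⟩
  obtain ⟨s, t, ⟨e⟩⟩ := exists_count_ne_zero_of_compMultiplicity_ne_zero hm
  have h1 : component (g : Aut (𝟭 C)).hom ((S i).1 ⊗ (S j).1) = ((l i : k) * l j) • 𝟙 _ := by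
    rw [component_tensor, hl, hl, smul_id_tensor_smul_id]
  have h2 := component_eq_smul_of_epi e.hom (s.component_factor_eq_smul t h1)
  rw [hl] at h2
  have := (S m).2
  exact Units.ext (smul_id_injective k (Simple.not_isZero (S m).1) h2).symm

/-- Every function in `fusionFunctions k S` comes from a monoidal automorphism, which acts on an
indecomposable object by the value of the function at any simple object in its block. -/
theorem exists_tensorAutId_of_mem_fusionFunctions [RigidCategory C] [IsTensorCategory k C]
    (hS : ∀ i, SimpleClass.mk C (S i) = i) {l : SimpleClass C → kˣ}
    (hl : l ∈ fusionFunctions k S) :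
    ∃ g : tensorAutId C,
      ∀ i, component (g : Aut (𝟭 C)).hom (S i).1 = (l i : k) • 𝟙 (S i).1 := by
  classical
  have := IsTensorCategory.finite_hom (k := k) (C := C)
  have hlen := IsTensorCategory.finite_length k (C := C)
  obtain ⟨hmul, hblock⟩ := hl
  have hex : ∀ X : {X : C // Indecomposable X}, ∃ i,
      SameBlock (simpleToIndecomposable (S i)) X := fun X => by
    obtain ⟨Z, hZ, f, hf⟩ := (hlen X.1).exists_nonzero_hom_simple X.2.1
    obtain ⟨i, ⟨e⟩⟩ := nonempty_iso_of_simple hS Z hZ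
    have hf' : f ≫ e.inv ≠ 0 := fun h => hf ((Preadditive.IsIso.comp_right_eq_zero _ _).1 h)
    exact ⟨i, .symm _ _ (.rel _ _ ⟨f ≫ e.inv, hf'⟩)⟩
  choose idx hidx using hex
  let wt : C → k := fun X => if hX : Indecomposable X then (l (idx ⟨X, hX⟩) : k) else 1
  have wt_eq {X : C} (hX : Indecomposable X) : wt X = l (idx ⟨X, hX⟩) := dif_pos hX
  have hwt : ∀ X Y : C, Indecomposable X → Indecomposable Y → ∀ f : X ⟶ Y, f ≠ 0 →
      wt X = wt Y := fun X Y hX hY f hf => by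
    rw [wt_eq hX, wt_eq hY, hblock _ _ (.trans _ _ _ (hidx ⟨X, hX⟩)
      (.trans _ _ _ (.rel _ _ ⟨f, hf⟩) (.symm _ _ (hidx ⟨Y, hY⟩))))]
  have wt_ne_zero (X : C) : wt X ≠ 0 := by
    simp only [wt]
    split_ifs
    · exact Units.ne_zero _
    · exact one_ne_zero
  let D : ∀ X : C, IndecDecomp X := fun X => (nonempty_indecDecomp k X).some
  have hsimple (i) : component (blockEnd D hwt) (S i).1 = (l i : k) • 𝟙 (S i).1 := by
    have hi := (simpleToIndecomposable (S i)).2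
    refine (component_blockEnd_of_indecomposable D hwt hi).trans ?_
    rw [wt_eq hi, hblock _ i (hidx _)]
    rfl
  have hscalar (X Y : C) (a b : k) (hX : component (blockEnd D hwt) X = a • 𝟙 X)
      (hY : component (blockEnd D hwt) Y = b • 𝟙 Y) :
      component (blockEnd D hwt) (X ⊗ Y) = (a * b) • 𝟙 (X ⊗ Y) := by
    refine component_tensor_eq_smul hlen
      (fun X c => component_blockEnd_eq_smul_of_sq_eq_zero D hwt) ?_ hX hY
    intro X Y hXs hYs a b hX hY
    obtain ⟨i, ⟨ei⟩⟩ := nonempty_iso_of_simple hS X hXs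
    obtain ⟨j, ⟨ej⟩⟩ := nonempty_iso_of_simple hS Y hYs
    have ha : a = l i := smul_id_injective k (Simple.not_isZero X)
      (hX.symm.trans (component_eq_smul_of_epi ei.hom (hsimple i)))
    have hb : b = l j := smul_id_injective k (Simple.not_isZero Y)
      (hY.symm.trans (component_eq_smul_of_epi ej.hom (hsimple j)))
    refine component_eq_smul_of_epi (ei.hom ⊗ₘ ej.hom) ?_
    let s : CompSeries ((S i).1 ⊗ (S j).1) := (hlen _).some
    refine s.induction (P := fun Z => component (blockEnd D hwt) Z = (a * b) • 𝟙 Z)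
      (fun Z hZ => hZ.eq_of_src _ _) (fun i _ hY hQ => ?_) fun t => ?_
    · exact component_blockEnd_eq_smul_of_sq_eq_zero D hwt
        (component_sub_smul_sq_eq_zero (𝟭 C) i hY hQ)
    · obtain ⟨m, ⟨em⟩⟩ := nonempty_iso_of_simple hS (s.factor t) (s.simple_quotient t)
      rw [ha, hb, ← Units.val_mul, hmul i j m (s.compMultiplicity_ne_zero t em.symm)]
      exact component_eq_smul_of_epi em.hom (hsimple m)
  have hiso := isIso_component_blockEnd D hwt wt_ne_zero
  have hiso' : ∀ X, IsIso ((blockEnd D hwt).app X) := hiso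
  have hisoD : IsIso (blockEnd D hwt) := NatIso.isIso_of_isIso_app _
  let g : Aut (𝟭 C) := asIso (blockEnd D hwt)
  refine ⟨⟨g, mem_tensorAutId ?_ (component_blockEnd_tensor D hwt hscalar)⟩, hsimple⟩
  -- the scalar `c` on the unit object satisfies `c * c = c`, because `𝟙_ C ⊗ 𝟙_ C ≅ 𝟙_ C`
  have hu := IsTensorCategory.simple_unit k (C := C)
  obtain ⟨c, hc⟩ := exists_component_eq_units_smul (k := k) g (𝟙_ C)
  have hcc : (c : k) * c = c := smul_id_injective k (Simple.not_isZero (𝟙_ C))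
    ((component_eq_smul_of_epi (λ_ (𝟙_ C)).hom (hscalar _ _ _ _ hc hc)).symm.trans hc)
  rw [hc, mul_eq_left₀ c.ne_zero |>.1 hcc, one_smul]

end Main

end FinTensorCat

theorem mainTheorem5 (k : Type w) [Field k] [IsAlgClosed k] [CharZero k]
    (C : Type u) [Category.{v} C] [Abelian C] [Linear k C]
    [MonoidalCategory C] [RigidCategory C] [MonoidalPreadditive C] [MonoidalLinear k C]
    [FinTensorCat.IsTensorCategory k C] (hfin : FinTensorCat.IsFiniteAbelian k C)
    (S : FinTensorCat.SimpleClass C → {X : C // Simple X})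
    (hS : ∀ i, FinTensorCat.SimpleClass.mk C (S i) = i) :
    ∃ e : FinTensorCat.tensorAutId C ≃* FinTensorCat.fusionFunctions k S,
      ∀ (g : FinTensorCat.tensorAutId C) (i : FinTensorCat.SimpleClass C),
        (g : Aut (𝟭 C)).hom.app (S i).1 =
          (((e g : FinTensorCat.SimpleClass C → kˣ) i : kˣ) : k) • 𝟙 (S i).1 := by
  open FinTensorCat in
  have := IsTensorCategory.finite_hom (k := k) (C := C)
  have hex (g : tensorAutId C) (i : SimpleClass C) :
      ∃ c : kˣ, component (g : Aut (𝟭 C)).hom (S i).1 = (c : k) • 𝟙 (S i).1 :=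
    have := (S i).2
    exists_component_eq_units_smul _ _
  choose l hl using hex
  have huniq (g : tensorAutId C) (i : SimpleClass C) (c : kˣ)
      (hc : component (g : Aut (𝟭 C)).hom (S i).1 = (c : k) • 𝟙 (S i).1) : l g i = c :=
    have := (S i).2
    Units.ext (smul_id_injective k (Simple.not_isZero (S i).1) ((hl g i).symm.trans hc))
  let φ : tensorAutId C →* fusionFunctions k S :=
    MonoidHom.mk' (fun g => ⟨l g, mem_fusionFunctions g (hl g)⟩) fun g h => by
      refine Subtype.ext (funext fun i => huniq _ _ _ ?_)
      change component (h : Aut (𝟭 C)).hom (S i).1 ≫ component (g : Aut (𝟭 C)).hom (S i).1 = _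
      rw [hl, hl]
      simp [smul_smul]
  have hinj : Function.Injective φ := by
    rw [injective_iff_map_eq_one]
    intro g hg
    have hgl (i) : l g i = 1 := congrFun (congrArg Subtype.val hg) i
    refine Subtype.ext (Iso.ext (eq_id_of_component_simple_eq_id k hfin (component_tensor g)
      fun Z hZ => ?_))
    obtain ⟨i, ⟨e⟩⟩ := nonempty_iso_of_simple hS Z hZ
    have h1 := hl g i
    rw [hgl] at h1
    have h2 := component_eq_smul_of_epi e.hom h1
    rwa [Units.val_one, one_smul] at h2
  have hsurj : Function.Surjective φ := fun ⟨m, hm⟩ => by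
    obtain ⟨g, hg⟩ := exists_tensorAutId_of_mem_fusionFunctions hS hm
    exact ⟨g, Subtype.ext (funext fun i => huniq g i _ (hg i))⟩
  exact ⟨MulEquiv.ofBijective φ ⟨hinj, hsurj⟩, hl⟩
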